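/- Let $E$ and $F$ be real Banach lattices. The solid hull of a subset $K$ of $E$ is $\mathrm{Sol}(K)=\{y\in E : |y|\le |x| \text{ for some } x\in K\}$, and a sequence $(x_n)$ in $E$ is disjoint if $|x_n|\wedge|x_m|=0$ whenever $n\neq m$. A norm bounded subset $K$ of $E$ is called disjointly weakly compact if every disjoint sequence $(x_n)\subset \mathrm{Sol}(K)$ converges weakly to $0$; the same terms are used in $F$. Let $T:E\to F$ be a continuous linear operator (not assumed to be positive or a lattice homomorphism). Then for every disjointly weakly compact subset $K$ of $E$, the image $T(K)$ is a disjointly weakly compact subset of $F$. -/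

import Mathlib

open Filter Topology

/-- A sequence in a vector lattice is disjoint if its terms are pairwise disjoint:
`|x n| ⊓ |x m| = 0` whenever `n ≠ m`. -/
def IsDisjointSeq {E : Type*} [Lattice E] [AddCommGroup E] (x : ℕ → E) : Prop :=
  ∀ n m : ℕ, n ≠ m → |x n| ⊓ |x m| = 0

/-- A subset `K` of a Banach lattice is disjointly weakly compact if it is norm bounded and every
disjoint sequence in its solid hull `{y | ∃ x ∈ K, |y| ≤ |x|}` converges weakly to zero. -/
def IsDisjointlyWeaklyCompact {E : Type*} [NormedAddCommGroup E] [NormedSpace ℝ E] [Lattice E]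
    (K : Set E) : Prop :=
  Bornology.IsBounded K ∧
    ∀ x : ℕ → E, IsDisjointSeq x →
      (∀ n, x n ∈ LatticeOrderedAddCommGroup.solidClosure K) →
      Tendsto (fun n => toWeakSpace ℝ E (x n)) atTop (𝓝 0)

/-! ### Riesz decomposition and truncation in lattice-ordered groups. -/

section OrderedGroup

variable {E : Type*} [Lattice E] [AddCommGroup E] [IsOrderedAddMonoid E]

/-! Suppose a disjoint sequence y_n in Sol(T(K)) has |g(y_n)| ≥ ε, with |y_n| ≤ |T x_n| and x_n ∈ K.
Take a positive majorant G of g. The components of G carried by the disjoint |y_n| have values at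
|z| adding up to at most G|z|; Hahn–Banach then gives functionals h_n with h_n(T x_n) ≥ ε and
∑|h_n(z)| ≤ G|z|. So φ_n = h_n ∘ T satisfies ∑|φ_n(x)| ≤ C‖x‖ and φ_n(x_n) ≥ ε, with no order
condition on T.

`exists_apply_lt` rules this out. By a Khinchin inequality, (∑ φ_n(x)²)^(1/2) ≤ f|x| for one
positive f (`exists_positive_square_majorant`). Up to a small f-error, K lies in an order interval
[-u, u] (`exists_apply_posPart_sub_le`), so the x_n may be replaced by y_n ∈ [-u, u] with φ_n(y_n) ≥
ε/2. Cauchy–Schwarz and `sum_le_of_abs_le` bound the sum of N such terms by √N f(u), whereas it is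
at least Nε/2. -/

theorem riesz_decomposition {a x y : E} (hx : 0 ≤ x) (hy : 0 ≤ y) (ha : 0 ≤ a)
    (hay : a ≤ x + y) :
    0 ≤ a ⊓ x ∧ 0 ≤ a - a ⊓ x ∧ a ⊓ x ≤ x ∧ a - a ⊓ x ≤ y := by
  refine ⟨le_inf ha hx, sub_nonneg.2 inf_le_left, inf_le_right, ?_⟩
  have h : a - y ≤ a ⊓ x :=
    le_inf (sub_le_self _ hy) (sub_le_iff_le_add.2 hay)
  exact sub_le_comm.1 h

theorem List.exists_riesz_decomposition (l : List E) (hl : ∀ a ∈ l, 0 ≤ a) {x y : E} (hx : 0 ≤ x)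
    (hy : 0 ≤ y) (h : l.sum = x + y) (p : E → ℝ) (hp : ∀ a b, p (a + b) ≤ p a + p b) :
    ∃ l₁ l₂ : List E, (∀ a ∈ l₁, 0 ≤ a) ∧ (∀ a ∈ l₂, 0 ≤ a) ∧ l₁.sum = x ∧ l₂.sum = y ∧
      (l.map p).sum ≤ (l₁.map p).sum + (l₂.map p).sum := by
  induction l generalizing x y with
  | nil =>
    have h0 : x + y = 0 := by simpa using h.symm
    obtain ⟨rfl, rfl⟩ := (add_eq_zero_iff_of_nonneg hx hy).1 h0
    exact ⟨[], [], by simp⟩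
  | cons a l ih =>
    simp only [List.mem_cons, forall_eq_or_imp] at hl
    have hs : 0 ≤ l.sum := List.sum_nonneg hl.2
    rw [List.sum_cons] at h
    obtain ⟨h1, h2, h3, h4⟩ := riesz_decomposition hx hy hl.1 (h ▸ le_add_of_nonneg_right hs)
    obtain ⟨l₁, l₂, p1, p2, s1, s2, hsum⟩ := ih hl.2 (sub_nonneg.2 h3) (sub_nonneg.2 h4)
      (by rw [← add_sub_cancel_left a l.sum, h]; abel)
    refine ⟨(a ⊓ x) :: l₁, (a - a ⊓ x) :: l₂, ?_, ?_, ?_, ?_, ?_⟩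
    · simpa [h1] using p1
    · simpa [h2] using p2
    · rw [List.sum_cons, s1]; abel
    · rw [List.sum_cons, s2]; abel
    · have := hp (a ⊓ x) (a - a ⊓ x)
      rw [add_sub_cancel] at this
      simp only [List.map_cons, List.sum_cons]
      linarith

theorem inf_add_le_add_inf {a b c : E} (ha : 0 ≤ a) (hb : 0 ≤ b) (hc : 0 ≤ c) :
    (a + b) ⊓ c ≤ a ⊓ c + b ⊓ c := by
  rw [add_inf, inf_add, inf_add]
  exact le_inf (le_inf inf_le_left (inf_le_right.trans (le_add_of_nonneg_right hb)))
      (le_inf (inf_le_right.trans (le_add_of_nonneg_left ha))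
        (inf_le_right.trans (le_add_of_nonneg_left hc)))

theorem sub_inf_eq_posPart (a b : E) : a - a ⊓ b = (a - b)⁺ := by
  rw [inf_eq_sub_posPart_sub]; abel

theorem exists_abs_le_list_sum (ψ : E →+ ℝ) (l : List E) (hl : ∀ a ∈ l, 0 ≤ a) :
    ∃ y, |y| ≤ l.sum ∧ (l.map fun a => |ψ a|).sum = ψ y := by
  induction l with
  | nil => exact ⟨0, by simp⟩
  | cons a l ih =>
    simp only [List.mem_cons, forall_eq_or_imp] at hl
    obtain ⟨y, hy, h⟩ := ih hl.2
    simp only [List.map_cons, List.sum_cons, h]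
    rcases abs_choice (ψ a) with e | e
    · exact ⟨a + y, (abs_add_le _ _).trans (add_le_add (abs_of_nonneg hl.1).le hy), by
        rw [e, map_add]⟩
    · exact ⟨-a + y, (abs_add_le _ _).trans (add_le_add
        (by rw [abs_neg]; exact (abs_of_nonneg hl.1).le) hy), by rw [e, map_add, map_neg]⟩

theorem exists_abs_le_and_abs_sub_le (x : E) {u : E} (hu : 0 ≤ u) :
    ∃ y, |y| ≤ u ∧ |x - y| ≤ (|x| - u)⁺ + (|x| - u)⁺ := by
  refine ⟨x⁺ ⊓ u - x⁻ ⊓ u, abs_le'.2 ⟨?_, ?_⟩, ?_⟩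
  · exact (sub_le_self _ (le_inf (negPart_nonneg x) hu)).trans inf_le_right
  · rw [neg_sub]
    exact (sub_le_self _ (le_inf (posPart_nonneg x) hu)).trans inf_le_right
  · have e : x - (x⁺ ⊓ u - x⁻ ⊓ u) = (x⁺ - u)⁺ - (x⁻ - u)⁺ := by
      rw [← sub_inf_eq_posPart, ← sub_inf_eq_posPart]
      nth_rw 1 [← posPart_sub_negPart x]
      abel
    rw [e, sub_eq_add_neg]
    refine (abs_add_le _ _).trans (add_le_add ?_ ?_)
    · rw [abs_of_nonneg (posPart_nonneg _), ← posPart_add_negPart x]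
      exact posPart_mono (sub_le_sub_right (le_add_of_nonneg_right (negPart_nonneg x)) u)
    · rw [abs_neg, abs_of_nonneg (posPart_nonneg _), ← posPart_add_negPart x]
      exact posPart_mono (sub_le_sub_right (le_add_of_nonneg_left (posPart_nonneg x)) u)

end OrderedGroup

/-! ### Positive functionals dominating a seminorm. -/

section NormedLattice

variable {E : Type*} [NormedAddCommGroup E] [Lattice E] [IsOrderedAddMonoid E] [HasSolidNorm E]

theorem norm_posPart_le (x : E) : ‖x⁺‖ ≤ ‖x‖ :=
  norm_le_norm_of_abs_le_abs (by
    rw [abs_of_nonneg (posPart_nonneg x), ← posPart_add_negPart]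
    exact le_add_of_nonneg_right (negPart_nonneg x))

theorem norm_negPart_le (x : E) : ‖x⁻‖ ≤ ‖x‖ := by
  simpa using norm_posPart_le (-x)

variable [NormedSpace ℝ E]

theorem exists_continuousLinearMap_extend_cone (V : E → ℝ) (C : ℝ)
    (hadd : ∀ x y, 0 ≤ x → 0 ≤ y → V (x + y) = V x + V y) (h0 : ∀ x, 0 ≤ x → 0 ≤ V x)
    (hC : ∀ x, 0 ≤ x → V x ≤ C * ‖x‖) :
    ∃ f : E →L[ℝ] ℝ, ∀ x, 0 ≤ x → f x = V x := by
  have hV0 : V 0 = 0 := by simpa using hadd 0 0 le_rfl le_rfl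
  let f : E →+ ℝ :=
    { toFun := fun x => V x⁺ - V x⁻
      map_zero' := by simp
      map_add' := fun x y => by
        have e : (x + y)⁺ + (x⁻ + y⁻) = (x + y)⁻ + (x⁺ + y⁺) := by
          have h1 := posPart_sub_negPart (x + y)
          have h2 := posPart_sub_negPart x
          have h3 := posPart_sub_negPart y
          rw [← sub_eq_zero]
          have : (x + y)⁺ + (x⁻ + y⁻) - ((x + y)⁻ + (x⁺ + y⁺)) =
            ((x + y)⁺ - (x + y)⁻) - (x⁺ - x⁻) - (y⁺ - y⁻) := by abel
          rw [this, h1, h2, h3]; abel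
        have e' := congrArg V e
        rw [hadd _ _ (posPart_nonneg _) (add_nonneg (negPart_nonneg _) (negPart_nonneg _)),
          hadd _ _ (negPart_nonneg _) (negPart_nonneg _),
          hadd _ _ (negPart_nonneg _) (add_nonneg (posPart_nonneg _) (posPart_nonneg _)),
          hadd _ _ (posPart_nonneg _) (posPart_nonneg _)] at e'
        linarith }
  have hfb : ∀ x, ‖f x‖ ≤ |C| * ‖x‖ := fun x => by
    have a1 := h0 _ (posPart_nonneg x)
    have a2 := h0 _ (negPart_nonneg x)
    have a3 : V x⁺ ≤ |C| * ‖x‖ := (hC _ (posPart_nonneg x)).trans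
      (mul_le_mul (le_abs_self C) (norm_posPart_le x) (norm_nonneg _) (abs_nonneg C))
    have a4 : V x⁻ ≤ |C| * ‖x‖ := (hC _ (negPart_nonneg x)).trans
      (mul_le_mul (le_abs_self C) (norm_negPart_le x) (norm_nonneg _) (abs_nonneg C))
    change |V x⁺ - V x⁻| ≤ _
    rw [abs_le]; constructor <;> linarith
  refine ⟨f.toRealLinearMap (AddMonoidHomClass.continuous_of_bound f |C| hfb), fun x hx => ?_⟩
  change V x⁺ - V x⁻ = V x
  rw [posPart_eq_self.2 hx, negPart_eq_zero.2 hx, hV0, sub_zero]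

/-- Riesz–Kantorovich: on the cone, f(x) is the supremum of ∑ p(a_i) over finite positive
decompositions x = ∑ a_i. Riesz decomposition gives subadditivity, concatenation of lists
superadditivity. -/
theorem exists_positive_majorant (p : E → ℝ) (C : ℝ) (hp0 : ∀ x, 0 ≤ p x)
    (hneg : ∀ x, p (-x) = p x) (hadd : ∀ x y, p (x + y) ≤ p x + p y)
    (hC : ∀ l : List E, (∀ a ∈ l, 0 ≤ a) → (l.map p).sum ≤ C * ‖l.sum‖) :
    ∃ f : E →L[ℝ] ℝ, (∀ x, 0 ≤ x → 0 ≤ f x) ∧ ∀ x, p x ≤ f |x| := by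
  let S : E → Set ℝ := fun x => {r | ∃ l : List E, (∀ a ∈ l, 0 ≤ a) ∧ l.sum = x ∧ (l.map p).sum = r}
  have hbdd : ∀ x, BddAbove (S x) := fun x => ⟨C * ‖x‖, by
    rintro r ⟨l, hl, rfl, rfl⟩; exact hC l hl⟩
  have hmem : ∀ x, 0 ≤ x → p x ∈ S x := fun x hx => ⟨[x], by simpa using hx, by simp, by simp⟩
  have hle : ∀ x, 0 ≤ x → p x ≤ sSup (S x) := fun x hx => le_csSup (hbdd x) (hmem x hx)
  obtain ⟨f, hf⟩ := exists_continuousLinearMap_extend_cone (fun x => sSup (S x)) C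
    (fun x y hx hy => by
      apply le_antisymm
      · refine csSup_le ⟨_, hmem _ (add_nonneg hx hy)⟩ ?_
        rintro r ⟨l, hl, hs, rfl⟩
        obtain ⟨l₁, l₂, p1, p2, s1, s2, h⟩ := l.exists_riesz_decomposition hl hx hy hs p hadd
        exact h.trans (add_le_add (le_csSup (hbdd x) ⟨l₁, p1, s1, rfl⟩)
          (le_csSup (hbdd y) ⟨l₂, p2, s2, rfl⟩))
      · rw [← le_sub_iff_add_le]
        refine csSup_le ⟨_, hmem _ hx⟩ ?_
        rintro r ⟨l, hl, rfl, rfl⟩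
        rw [le_sub_comm]
        refine csSup_le ⟨_, hmem _ hy⟩ ?_
        rintro r ⟨l', hl', rfl, rfl⟩
        rw [le_sub_iff_add_le, add_comm]
        refine le_csSup (hbdd _) ⟨l ++ l', ?_, by simp, by simp⟩
        intro a ha
        rcases List.mem_append.1 ha with h | h
        exacts [hl a h, hl' a h])
    (fun x hx => (hp0 x).trans (hle x hx))
    (fun x hx => csSup_le ⟨_, hmem _ hx⟩ (by rintro r ⟨l, hl, rfl, rfl⟩; exact hC l hl))
  refine ⟨f, fun x hx => (hf x hx).symm ▸ (hp0 x).trans (hle x hx), fun x => ?_⟩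
  calc p x = p (x⁺ + -x⁻) := by rw [← sub_eq_add_neg, posPart_sub_negPart]
    _ ≤ p x⁺ + p x⁻ := (hadd _ _).trans_eq (by rw [hneg])
    _ ≤ f x⁺ + f x⁻ := by
      rw [hf _ (posPart_nonneg x), hf _ (negPart_nonneg x)]
      exact add_le_add (hle _ (posPart_nonneg x)) (hle _ (negPart_nonneg x))
    _ = f |x| := by rw [← map_add, posPart_add_negPart]

theorem list_sum_abs_le (ψ : E →ₗ[ℝ] ℝ) {C : ℝ} (hC : 0 ≤ C) (hψ : ∀ x, |ψ x| ≤ C * ‖x‖)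
    (l : List E) (hl : ∀ a ∈ l, 0 ≤ a) : (l.map fun a => |ψ a|).sum ≤ C * ‖l.sum‖ := by
  obtain ⟨y, hy, h⟩ := exists_abs_le_list_sum ψ.toAddMonoidHom l hl
  refine h.le.trans ?_
  refine (le_abs_self _).trans ((hψ y).trans (mul_le_mul_of_nonneg_left ?_ hC))
  exact norm_le_norm_of_abs_le_abs (hy.trans (le_abs_self _))

end NormedLattice

/-! ### A Khinchin inequality for finite lists. -/

/-- Start from |t| ≥ (3/2) r t² − (1/2) r³ t⁴ and average over the signs one at a time. The quartic
t⁴ + 6t²S + 3S² is the Gaussian fourth moment, which dominates that of random signs. -/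
theorem list_sum_heatPolynomial_le {ι : Type*} (l : List ι) (c : ℕ → ι → ℝ) (r : ι → ℝ)
    (hr : ∀ i, 0 ≤ r i) (B : ℝ) (N : ℕ) (t : ι → ℝ)
    (h : ∀ a : ℕ → ℝ, (∀ n, |a n| = 1) →
      (l.map fun i => |t i + ∑ n ∈ Finset.range N, a n * c n i|).sum ≤ B) :
    (l.map fun i => 3 / 2 * r i * (t i ^ 2 + ∑ n ∈ Finset.range N, c n i ^ 2) -
      1 / 2 * r i ^ 3 * (t i ^ 4 + 6 * t i ^ 2 * (∑ n ∈ Finset.range N, c n i ^ 2) +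
        3 * (∑ n ∈ Finset.range N, c n i ^ 2) ^ 2)).sum ≤ B := by
  induction N generalizing t with
  | zero =>
    refine le_trans (List.sum_le_sum fun i _ => ?_) (h (fun _ => 1) (by simp))
    simp only [Finset.range_zero, Finset.sum_empty]
    have key : 3 / 2 * (r i * |t i| ^ 2) - 1 / 2 * (r i ^ 3 * |t i| ^ 4) ≤ |t i| := by
      have h1 : 0 ≤ r i * |t i| := mul_nonneg (hr i) (abs_nonneg _)
      have h2 : 0 ≤ |t i| * ((r i * |t i| - 1) ^ 2 * (r i * |t i| + 2)) :=
        mul_nonneg (abs_nonneg _) (mul_nonneg (sq_nonneg _) (by linarith))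
      nlinarith
    have e2 : |t i| ^ 2 = t i ^ 2 := sq_abs _
    have e4 : |t i| ^ 4 = t i ^ 4 := by rw [show 4 = 2 * 2 from rfl, pow_mul, pow_mul, e2]
    rw [e2, e4] at key
    simp only [add_zero, mul_zero]
    linarith
  | succ N ih =>
    have step : ∀ σ : ℝ, |σ| = 1 → _ := fun σ hσ => ih (fun i => t i + σ * c N i) fun a ha => by
      refine le_trans (le_of_eq ?_) (h (Function.update a N σ) fun n => by
        by_cases hn : n = N
        · subst hn; simpa using hσ
        · simpa [Function.update_of_ne hn] using ha n)
      congr 1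
      refine List.map_congr_left fun i _ => ?_
      rw [Finset.sum_range_succ, Function.update_self, add_assoc, add_comm (σ * c N i)]
      congr 3
      refine Finset.sum_congr rfl fun n hn => ?_
      rw [Function.update_of_ne (Finset.mem_range.1 hn).ne]
    have hsum := add_le_add (step 1 (by simp)) (step (-1) (by simp))
    rw [← List.sum_map_add] at hsum
    rw [← mul_le_mul_iff_of_pos_left (two_pos : (0 : ℝ) < 2), ← List.sum_map_mul_left, two_mul B]
    refine le_trans (List.sum_le_sum fun i _ => ?_) hsum
    rw [Finset.sum_range_succ]
    -- Each averaged sign raises the Gaussian moment above the sign moment by 2c⁴.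
    have : 0 ≤ r i ^ 3 * c N i ^ 4 := mul_nonneg (pow_nonneg (hr i) 3) (by positivity)
    nlinarith

theorem list_sum_sqrt_le {ι : Type*} (l : List ι) (c : ℕ → ι → ℝ) (B : ℝ) (N : ℕ)
    (h : ∀ a : ℕ → ℝ, (∀ n, |a n| = 1) →
      (l.map fun i => |∑ n ∈ Finset.range N, a n * c n i|).sum ≤ B) :
    (l.map fun i => √(∑ n ∈ Finset.range N, c n i ^ 2)).sum ≤ 2 * B := by
  -- With r = 1/(2√S) and t = 0 the polynomial equals (9/16)√S, which is at least √S/2.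
  have key := list_sum_heatPolynomial_le l c
    (fun i => 1 / 2 * (√(∑ n ∈ Finset.range N, c n i ^ 2))⁻¹) (fun i => by positivity) B N 0
    (by simpa using h)
  refine le_trans ?_ (mul_le_mul_of_nonneg_left key zero_le_two)
  rw [← List.sum_map_mul_left]
  refine (List.sum_le_sum fun i _ => ?_)
  set S := ∑ n ∈ Finset.range N, c n i ^ 2 with hS
  have hS0 : 0 ≤ S := Finset.sum_nonneg fun n _ => sq_nonneg _
  have hq : S = √S ^ 2 := (Real.sq_sqrt hS0).symm
  rcases eq_or_lt_of_le (Real.sqrt_nonneg S) with h0 | h0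
  · simp [← h0]
  · simp only [Pi.zero_apply]
    generalize √S = q at *
    rw [hq]
    have : q ≠ 0 := h0.ne'
    field_simp
    nlinarith [pow_pos h0 4]

/-! ### The positive majorant of the square function. -/

section

variable {E : Type*} [NormedAddCommGroup E] [Lattice E] [IsOrderedAddMonoid E] [HasSolidNorm E]
  [NormedSpace ℝ E]

theorem sqrt_sum_sq_add_le (N : ℕ) (a b : ℕ → ℝ) :
    √(∑ n ∈ Finset.range N, (a n + b n) ^ 2) ≤
      √(∑ n ∈ Finset.range N, a n ^ 2) + √(∑ n ∈ Finset.range N, b n ^ 2) := by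
  have := Real.Lp_add_le (Finset.range N) a b (p := 2) (by norm_num)
  simpa [Real.sqrt_eq_rpow] using this

theorem exists_positive_square_majorant (φ : ℕ → E →ₗ[ℝ] ℝ) {C : ℝ} (hC : 0 ≤ C)
    (hφ : ∀ N x, ∑ n ∈ Finset.range N, |φ n x| ≤ C * ‖x‖) :
    ∃ f : E →L[ℝ] ℝ, (∀ x, 0 ≤ x → 0 ≤ f x) ∧
      ∀ N x, √(∑ n ∈ Finset.range N, φ n x ^ 2) ≤ f |x| := by
  let q : ℕ → E → ℝ := fun N x => √(∑ n ∈ Finset.range N, φ n x ^ 2)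
  have hlist : ∀ N, ∀ l : List E, (∀ a ∈ l, 0 ≤ a) → (l.map (q N)).sum ≤ 2 * C * ‖l.sum‖ :=
    fun N l hl => by
    rw [mul_assoc]
    refine list_sum_sqrt_le l (fun n x => φ n x) (C * ‖l.sum‖) N fun a ha => ?_
    have := list_sum_abs_le (∑ n ∈ Finset.range N, a n • φ n) hC (fun x => by
      simp only [LinearMap.sum_apply, LinearMap.smul_apply, smul_eq_mul]
      refine (Finset.abs_sum_le_sum_abs _ _).trans (le_trans (le_of_eq ?_) (hφ N x))
      simp [abs_mul, ha]) l hl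
    simpa using this
  have hmono : ∀ x, Monotone fun N => q N x := fun x M N hMN =>
    Real.sqrt_le_sqrt (Finset.sum_le_sum_of_subset_of_nonneg
      (Finset.range_mono hMN) fun _ _ _ => sq_nonneg _)
  have hb : ∀ x, BddAbove (Set.range fun N => q N x) := fun x => ⟨C * ‖x‖, by
    rintro _ ⟨N, rfl⟩
    refine Real.sqrt_le_iff.2 ⟨by positivity, ?_⟩
    refine le_trans ?_ (pow_le_pow_left₀ (Finset.sum_nonneg fun _ _ => abs_nonneg _) (hφ N x) 2)
    refine le_trans (le_of_eq ?_) (Finset.sum_sq_le_sq_sum_of_nonneg (fun n _ => abs_nonneg (φ n x)))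
    simp⟩
  have htend : ∀ x, Tendsto (fun N => q N x) atTop (𝓝 (⨆ N, q N x)) := fun x =>
    tendsto_atTop_ciSup (hmono x) (hb x)
  obtain ⟨f, hf, hle⟩ := exists_positive_majorant (fun x => ⨆ N, q N x) (2 * C)
    (fun x => (Real.sqrt_nonneg _).trans (le_ciSup (hb x) 0)) (fun x => by simp [q])
    (fun x y => ciSup_le fun N => by
      refine le_trans ?_ (add_le_add (le_ciSup (hb x) N) (le_ciSup (hb y) N))
      simpa [q] using sqrt_sum_sq_add_le N (fun n => φ n x) (fun n => φ n y))
    (fun l hl => by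
      have : Tendsto (fun N => (l.map (q N)).sum) atTop (𝓝 (l.map fun x => ⨆ N, q N x).sum) :=
        tendsto_list_sum l fun x _ => htend x
      exact le_of_tendsto' this fun N => hlist N l hl)
  exact ⟨f, hf, fun N x => (le_ciSup (hb x) N).trans (hle x)⟩

end

/-! ### Disjoint positive parts, and sums over an order interval. -/

theorem smul_posPart_of_nonneg {E : Type*} [AddCommGroup E] [Module ℝ E] [Lattice E]
    [IsOrderedAddMonoid E] [IsOrderedModule ℝ E] {c : ℝ} (hc : 0 ≤ c) (a : E) :
    (c • a)⁺ = c • a⁺ := by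
  rcases hc.eq_or_lt with rfl | hc
  · simp
  · have h := (OrderIso.smulRight (β := E) hc).map_sup a 0
    simp only [OrderIso.smulRight_apply, smul_zero] at h
    exact h.symm

theorem posPart_inf_posPart_eq_zero {E : Type*} [AddCommGroup E] [Module ℝ E]
    [Lattice E] [IsOrderedAddMonoid E] [IsOrderedModule ℝ E] {a b p q : E} {r s : ℝ} (hr : 1 ≤ r) (hs : 1 ≤ r * s)
    (hb : 0 ≤ b) (hp : r • a ≤ p) (hq : s • b ≤ q) :
    (b - p)⁺ ⊓ (a - q)⁺ = 0 := by
  have hr0 : 0 ≤ r := zero_le_one.trans hr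
  refine le_antisymm ?_ (le_inf (posPart_nonneg _) (posPart_nonneg _))
  rw [← posPart_inf_negPart_eq_zero (b - r • a)]
  refine inf_le_inf (posPart_mono (sub_le_sub_left hp _)) ?_
  calc (a - q)⁺ ≤ r • (a - q)⁺ := le_smul_of_one_le_left (posPart_nonneg _) hr
    _ = (r • a - r • q)⁺ := by rw [← smul_posPart_of_nonneg hr0, smul_sub]
    _ ≤ (r • a - b)⁺ := by
      refine posPart_mono (sub_le_sub_left ?_ _)
      refine le_trans ?_ (smul_le_smul_of_nonneg_left hq hr0)
      rw [smul_smul]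
      exact le_smul_of_one_le_left hb hs
    _ = (b - r • a)⁻ := by rw [← posPart_neg, neg_sub]

section

variable {E : Type*} [AddCommGroup E] [Module ℝ E] [Lattice E] [IsOrderedAddMonoid E]

/-- S contains the indices where w n is not an endpoint of [0, U]. Splitting U as w m + (U − w m),
and every w n accordingly, makes index m extreme in both pieces and keeps extreme indices extreme.
-/
theorem sum_extreme_le (φ : ℕ → E →ₗ[ℝ] ℝ) (g : E →ₗ[ℝ] ℝ) (N : ℕ)
    (hg : ∀ x, 0 ≤ x → ∑ n ∈ Finset.range N, |φ n x| ≤ g x) (S : Finset ℕ) :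
    ∀ U : E, 0 ≤ U → ∀ w : ℕ → E, (∀ n, 0 ≤ w n) → (∀ n, w n ≤ U) →
      (∀ n < N, n ∉ S → w n = 0 ∨ w n = U) →
        ∑ n ∈ Finset.range N, φ n (w n + w n - U) ≤ g U := by
  induction S using Finset.induction_on with
  | empty =>
    intro U hU w _ _ hw
    refine le_trans (Finset.sum_le_sum fun n hn => ?_) (hg U hU)
    rcases hw n (Finset.mem_range.1 hn) (by simp) with h | h
    · rw [h, add_zero, zero_sub, map_neg]; exact neg_le_abs _
    · rw [h, add_sub_cancel_right]; exact le_abs_self _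
  | insert m S _ ih =>
    intro U hU w w0 wU hw
    have h1 := ih (w m) (w0 m) (fun n => w n ⊓ w m) (fun n => le_inf (w0 n) (w0 m))
      (fun n => inf_le_right) (fun n hn hnS => by
        by_cases hnm : n = m
        · subst hnm; right; simp
        · rcases hw n hn (by simp [hnm, hnS]) with h | h
          · left; simp [h, w0 m]
          · right; simp [h, wU m])
    have h2 := ih (U - w m) (sub_nonneg.2 (wU m)) (fun n => w n - w n ⊓ w m)
      (fun n => sub_nonneg.2 inf_le_left)
      (fun n => (riesz_decomposition (w0 m) (sub_nonneg.2 (wU m)) (w0 n)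
        (by rw [add_sub_cancel]; exact wU n)).2.2.2) (fun n hn hnS => by
        by_cases hnm : n = m
        · subst hnm; left; simp
        · rcases hw n hn (by simp [hnm, hnS]) with h | h
          · left; simp [h, w0 m]
          · right; simp [h, wU m])
    have h3 := add_le_add h1 h2
    rw [← Finset.sum_add_distrib, ← map_add, add_sub_cancel] at h3
    refine le_trans (le_of_eq (Finset.sum_congr rfl fun n _ => ?_)) h3
    rw [← map_add]
    congr 1
    abel

theorem sum_le_of_abs_le (φ : ℕ → E →ₗ[ℝ] ℝ) (g : E →ₗ[ℝ] ℝ) (N : ℕ)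
    (hg : ∀ x, 0 ≤ x → ∑ n ∈ Finset.range N, |φ n x| ≤ g x) {u : E} {y : ℕ → E}
    (hy : ∀ n, |y n| ≤ u) : ∑ n ∈ Finset.range N, φ n (y n) ≤ g u := by
  have h := sum_extreme_le φ g N hg (Finset.range N) (u + u)
    (add_nonneg ((abs_nonneg _).trans (hy 0)) ((abs_nonneg _).trans (hy 0))) (fun n => y n + u)
    (fun n => neg_le_iff_add_nonneg'.1 (abs_le'.1 (hy n)).2)
    (fun n => add_le_add (abs_le'.1 (hy n)).1 le_rfl)
    (fun n hn h => absurd (Finset.mem_range.2 hn) h)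
  have e : ∀ n, φ n (y n + u + (y n + u) - (u + u)) = 2 * φ n (y n) := fun n => by
    rw [show y n + u + (y n + u) - (u + u) = y n + y n by abel, map_add, two_mul]
  simp only [e, map_add, ← Finset.mul_sum] at h
  linarith

end

theorem tendsto_toWeakSpace_zero_iff {E : Type*} [NormedAddCommGroup E] [NormedSpace ℝ E]
    (x : ℕ → E) : Tendsto (fun n => toWeakSpace ℝ E (x n)) atTop (𝓝 0) ↔
      ∀ g : E →L[ℝ] ℝ, Tendsto (fun n => g (x n)) atTop (𝓝 0) := by
  have hinj : Function.Injective (topDualPairing ℝ E).flip := fun a b hab => by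
    by_contra hne
    obtain ⟨g, hg⟩ := SeparatingDual.exists_separating_of_ne (R := ℝ) hne
    exact hg (DFunLike.congr_fun hab g)
  refine (WeakBilin.tendsto_iff_forall_eval_tendsto (topDualPairing ℝ E).flip hinj).trans ?_
  refine forall_congr' fun g => ?_
  change Tendsto _ _ (𝓝 (g 0)) ↔ _
  rw [map_zero]
  rfl

/-! ### Disjointly weakly compact sets and summable functionals. -/

section

variable {E : Type*} [NormedAddCommGroup E] [NormedSpace ℝ E] [CompleteSpace E]
  [Lattice E] [IsOrderedAddMonoid E] [IsOrderedModule ℝ E] [HasSolidNorm E]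

theorem IsDisjointlyWeaklyCompact.exists_apply_posPart_sub_le {K : Set E}
    (hK : IsDisjointlyWeaklyCompact K) (f : E →L[ℝ] ℝ) (hf : ∀ x, 0 ≤ x → 0 ≤ f x) {ε : ℝ}
    (hε : 0 < ε) : ∃ u, 0 ≤ u ∧ ∀ x ∈ K, f (|x| - u)⁺ ≤ ε := by
  by_contra! hcon
  choose! X hXK hX using hcon
  let s : ℕ → E := fun n => Nat.rec 0 (fun n u => u + |X ((4 : ℝ) ^ n • u)|) n
  let x : ℕ → E := fun n => X ((4 : ℝ) ^ n • s n)
  have hs : ∀ n, s (n + 1) = s n + |x n| := fun n => rfl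
  have hs0 : ∀ n, 0 ≤ s n := fun n => by
    induction n with
    | zero => exact le_rfl
    | succ n ih => rw [hs]; exact add_nonneg ih (abs_nonneg _)
  have hsmono : Monotone s := monotone_nat_of_le_succ fun n => by
    rw [hs]; exact le_add_of_nonneg_right (abs_nonneg _)
  have hxs : ∀ {m n}, m < n → |x m| ≤ s n := fun {m n} hmn =>
    le_trans (by rw [hs]; exact le_add_of_nonneg_left (hs0 m)) (hsmono (Nat.succ_le_of_lt hmn))
  have hu : ∀ n, 0 ≤ (4 : ℝ) ^ n • s n := fun n => smul_nonneg (by positivity) (hs0 n)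
  have hxK : ∀ n, x n ∈ K := fun n => hXK _ (hu n)
  have hxε : ∀ n, ε < f (|x n| - (4 : ℝ) ^ n • s n)⁺ := fun n => hX _ (hu n)
  obtain ⟨R, hR⟩ := hK.1.exists_norm_le
  have hsum : Summable fun n => ((1 / 2 : ℝ) ^ n) • |x n| := by
    refine Summable.of_norm_bounded (g := fun n => (1 / 2 : ℝ) ^ n * R)
      (summable_geometric_two.mul_right R) fun n => ?_
    rw [norm_smul, norm_abs_eq_norm, norm_pow, Real.norm_of_nonneg (by norm_num)]
    exact mul_le_mul_of_nonneg_left (hR _ (hxK n)) (by positivity)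
  have hterm : ∀ n, 0 ≤ ((1 / 2 : ℝ) ^ n) • |x n| := fun n =>
    smul_nonneg (by positivity) (abs_nonneg _)
  set y := ∑' n, ((1 / 2 : ℝ) ^ n) • |x n| with hy
  have hxy : ∀ n, ((1 / 2 : ℝ) ^ n) • |x n| ≤ y := fun n => hsum.le_tsum n fun m _ => hterm m
  have hy0 : 0 ≤ y := (hterm 0).trans (hxy 0)
  have hy0' : ∀ n, 0 ≤ (1 / 2 : ℝ) ^ n • y := fun n => smul_nonneg (by positivity) hy0
  -- The term 4ⁿ s n handles earlier x m and 2⁻ⁿ y later ones. For m < n disjointness holds because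
  -- 4ⁿ · 2⁻ᵐ · 2⁻ⁿ = 2ⁿ⁻ᵐ ≥ 1.
  let v : ℕ → E := fun n => (|x n| - ((4 : ℝ) ^ n • s n + (1 / 2 : ℝ) ^ n • y))⁺
  have hv0 : ∀ n, |v n| = v n := fun n => abs_of_nonneg (posPart_nonneg _)
  have hlt : ∀ {m n}, m < n → v n ⊓ v m = 0 := fun {m n} hmn => by
    refine posPart_inf_posPart_eq_zero (r := 4 ^ n) (s := (1 / 2) ^ m * (1 / 2) ^ n)
      (one_le_pow₀ (by norm_num)) ?_ (abs_nonneg _) ?_ ?_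
    · obtain ⟨k, rfl⟩ := Nat.exists_eq_add_of_lt hmn
      have : (4 : ℝ) ^ (m + k + 1) * ((1 / 2) ^ m * (1 / 2) ^ (m + k + 1)) = 2 ^ (k + 1) := by
        rw [show (4 : ℝ) = 2 * 2 by norm_num, mul_pow, one_div, inv_pow, inv_pow]
        field_simp
        ring
      rw [this]
      exact one_le_pow₀ one_le_two
    · exact (smul_le_smul_of_nonneg_left (hxs hmn) (by positivity)).trans
        (le_add_of_nonneg_right (hy0' n))
    · rw [mul_smul]
      exact (smul_le_smul_of_nonneg_left (hxy n) (by positivity)).trans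
        (le_add_of_nonneg_left (hu m))
  have hdisj : IsDisjointSeq v := fun n m hnm => by
    rw [hv0, hv0]
    rcases lt_or_gt_of_ne hnm with h | h
    · rw [inf_comm]; exact hlt h
    · exact hlt h
  have hmem : ∀ n, v n ∈ LatticeOrderedAddCommGroup.solidClosure K := fun n =>
    ⟨x n, hxK n, by
      rw [hv0]
      exact sup_le (sub_le_self _ (add_nonneg (hu n) (hy0' n))) (abs_nonneg _)⟩
  have hv := (tendsto_toWeakSpace_zero_iff v).1 (hK.2 v hdisj hmem) f
  have hg : Tendsto (fun n : ℕ => (1 / 2 : ℝ) ^ n * f y) atTop (𝓝 0) := by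
    simpa using (tendsto_pow_atTop_nhds_zero_of_lt_one (r := (1 / 2 : ℝ)) (by norm_num)
      (by norm_num)).mul_const (f y)
  have hlim := hv.add hg
  rw [add_zero] at hlim
  refine absurd (ge_of_tendsto' hlim fun n => (hxε n).le.trans ?_) (not_le.2 hε)
  rw [← smul_eq_mul, ← map_smul, ← map_add, ← sub_nonneg, ← map_sub]
  refine hf _ (sub_nonneg.2 (sup_le ?_ (add_nonneg (posPart_nonneg _) (hy0' n))))
  rw [← sub_le_iff_le_add, sub_sub]
  exact le_posPart _

theorem IsDisjointlyWeaklyCompact.exists_apply_lt {K : Set E}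
    (hK : IsDisjointlyWeaklyCompact K) (φ : ℕ → E →ₗ[ℝ] ℝ) {C : ℝ} (hC : 0 ≤ C)
    (hφ : ∀ N x, ∑ n ∈ Finset.range N, |φ n x| ≤ C * ‖x‖) {x : ℕ → E} (hx : ∀ n, x n ∈ K)
    {ε : ℝ} (hε : 0 < ε) : ∃ n, φ n (x n) < ε := by
  by_contra! hcon
  obtain ⟨f, hf, hle⟩ := exists_positive_square_majorant φ hC hφ
  -- The truncation error is bounded by two copies of (|x| − u)⁺, so ε/4 leaves φ n (y n) ≥ ε/2.
  obtain ⟨u, hu, hfu⟩ := hK.exists_apply_posPart_sub_le f hf (ε := ε / 4) (by positivity)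
  choose y hyu hxy using fun n => exists_abs_le_and_abs_sub_le (x n) hu
  have hmono : ∀ a b, a ≤ b → f a ≤ f b := fun a b hab => by
    have := hf _ (sub_nonneg.2 hab); rw [map_sub] at this; linarith
  have hone : ∀ n z, |φ n z| ≤ f |z| := fun n z => by
    refine le_trans ?_ (hle (n + 1) z)
    refine Real.abs_le_sqrt ?_
    rw [Finset.sum_range_succ]
    exact le_add_of_nonneg_left (Finset.sum_nonneg fun _ _ => sq_nonneg _)
  have hy : ∀ n, ε / 2 ≤ φ n (y n) := fun n => by
    have h1 := (le_abs_self _).trans ((hone n (x n - y n)).trans (hmono _ _ (hxy n)))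
    rw [map_sub, map_add] at h1
    have := hfu _ (hx n)
    have := hcon n
    linarith
  have hsum : ∀ N : ℕ, N * (ε / 2) ≤ √N * f u := fun N => by
    have h := sum_le_of_abs_le φ (√N • (f : E →ₗ[ℝ] ℝ)) N (fun z hz => by
      have h2 := hle N z
      rw [abs_of_nonneg hz] at h2
      refine le_trans ?_ (mul_le_mul_of_nonneg_left h2 (Real.sqrt_nonneg _))
      rw [← Real.sqrt_mul (Nat.cast_nonneg N)]
      refine Real.le_sqrt_of_sq_le ?_
      simpa using sq_sum_le_card_mul_sum_sq (s := Finset.range N) (f := fun n => |φ n z|)) hyu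
    refine le_trans ?_ h
    simpa using Finset.card_nsmul_le_sum (Finset.range N) (fun n => φ n (y n)) (ε / 2)
      fun n _ => hy n
  have hsq : ∀ N : ℕ, √N * (ε / 2) ≤ f u := fun N => by
    rcases (Real.sqrt_nonneg (N : ℝ)).eq_or_lt with h | h
    · rw [← h, zero_mul]; exact hf u hu
    · refine le_of_mul_le_mul_left ?_ h
      rw [← mul_assoc, Real.mul_self_sqrt (Nat.cast_nonneg N)]
      exact hsum N
  have hlim : Tendsto (fun N : ℕ => √(N : ℝ) * (ε / 2)) atTop atTop :=
    (Real.tendsto_sqrt_atTop.comp tendsto_natCast_atTop_atTop).atTop_mul_const (by positivity)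
  obtain ⟨N, hN⟩ := (hlim.eventually_gt_atTop (f u)).exists
  exact absurd (hsq N) (not_le.2 hN)

end

/-! ### Carrier seminorms of disjoint elements. -/

theorem smul_inf_of_nonneg {F : Type*} [AddCommGroup F] [Lattice F] [Module ℝ F]
    [IsOrderedModule ℝ F] {c : ℝ} (hc : 0 ≤ c) (a b : F) :
    c • (a ⊓ b) = c • a ⊓ c • b := by
  rcases hc.eq_or_lt with rfl | hc
  · simp
  · exact (OrderIso.smulRight (β := F) hc).map_inf a b

theorem map_le_map_of_nonneg {F : Type*} [AddCommGroup F] [Lattice F] [IsOrderedAddMonoid F]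
    [Module ℝ F] {G : F →ₗ[ℝ] ℝ} (hG : ∀ x, 0 ≤ x → 0 ≤ G x) {x y : F}
    (h : x ≤ y) : G x ≤ G y := by
  have := hG _ (sub_nonneg.2 h)
  rw [map_sub] at this
  linarith

/-- The seminorm `z ↦ sup_k G (|z| ⊓ k b)`, which is the value at `|z|` of the component of the
positive functional `G` carried by `b`. -/
noncomputable def carrierSeminorm {F : Type*} [AddCommGroup F] [Lattice F] [Module ℝ F]
    (G : F →ₗ[ℝ] ℝ) (b z : F) : ℝ :=
  ⨆ k : ℕ, G (|z| ⊓ (k : ℝ) • b)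

theorem carrierSeminorm_neg {F : Type*} [AddCommGroup F] [Lattice F] [Module ℝ F]
    (G : F →ₗ[ℝ] ℝ) (b z : F) : carrierSeminorm G b (-z) = carrierSeminorm G b z := by
  simp [carrierSeminorm]

section

variable {F : Type*} [AddCommGroup F] [Lattice F] [IsOrderedAddMonoid F]

theorem sum_inf_le_of_pairwise_inf_eq_zero {z : F} (hz : 0 ≤ z) {d : ℕ → F} (hd : ∀ n, 0 ≤ d n)
    (hdisj : ∀ n m, n ≠ m → d n ⊓ d m = 0) (N : ℕ) : ∑ n ∈ Finset.range N, z ⊓ d n ≤ z := by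
  -- Disjointness from later d m is carried along, since it turns each new sum into a supremum.
  suffices h : ∑ n ∈ Finset.range N, z ⊓ d n ≤ z ∧
      ∀ m, N ≤ m → (∑ n ∈ Finset.range N, z ⊓ d n) ⊓ d m = 0 from h.1
  have hzd : ∀ n, 0 ≤ z ⊓ d n := fun n => le_inf hz (hd n)
  induction N with
  | zero => simp [hz, hd]
  | succ N ih =>
    have hs : 0 ≤ ∑ n ∈ Finset.range N, z ⊓ d n := Finset.sum_nonneg fun n _ => hzd n
    rw [Finset.sum_range_succ]
    refine ⟨?_, fun m hm => le_antisymm ?_ (le_inf (add_nonneg hs (hzd N)) (hd m))⟩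
    · have h0 : (∑ n ∈ Finset.range N, z ⊓ d n) ⊓ (z ⊓ d N) = 0 :=
        le_antisymm ((inf_le_inf_left _ inf_le_right).trans (ih.2 N le_rfl).le)
          (le_inf hs (hzd N))
      rw [← inf_add_sup, h0, zero_add]
      exact sup_le ih.1 inf_le_left
    · refine (inf_add_le_add_inf hs (hzd N) (hd m)).trans ?_
      rw [ih.2 m (Nat.le_of_succ_le hm), zero_add, ← hdisj N m (Nat.lt_of_succ_le hm).ne]
      exact inf_le_inf_right _ inf_le_right

variable [Module ℝ F]

variable {G : F →ₗ[ℝ] ℝ} {b : F}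

theorem bddAbove_carrier (hG : ∀ x, 0 ≤ x → 0 ≤ G x) (b z : F) :
    BddAbove (Set.range fun k : ℕ => G (|z| ⊓ (k : ℝ) • b)) := ⟨G |z|, by
  rintro _ ⟨k, rfl⟩
  exact map_le_map_of_nonneg hG inf_le_left⟩

theorem le_carrierSeminorm (hG : ∀ x, 0 ≤ x → 0 ≤ G x) (b z : F) (k : ℕ) :
    G (|z| ⊓ (k : ℝ) • b) ≤ carrierSeminorm G b z :=
  le_ciSup (bddAbove_carrier hG b z) k

variable [IsOrderedModule ℝ F]

theorem tendsto_carrierSeminorm (hG : ∀ x, 0 ≤ x → 0 ≤ G x) (hb : 0 ≤ b) (z : F) :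
    Tendsto (fun k : ℕ => G (|z| ⊓ (k : ℝ) • b)) atTop (𝓝 (carrierSeminorm G b z)) :=
  tendsto_atTop_ciSup (fun _ _ hkl => map_le_map_of_nonneg hG
    (inf_le_inf_left _ (smul_le_smul_of_nonneg_right (Nat.cast_le.2 hkl) hb)))
    (bddAbove_carrier hG b z)

theorem carrierSeminorm_add_le (hG : ∀ x, 0 ≤ x → 0 ≤ G x) (hb : 0 ≤ b) (z w : F) :
    carrierSeminorm G b (z + w) ≤ carrierSeminorm G b z + carrierSeminorm G b w :=
  ciSup_le fun k => by
    refine le_trans ?_ (add_le_add (le_carrierSeminorm hG b z k) (le_carrierSeminorm hG b w k))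
    rw [← map_add]
    exact map_le_map_of_nonneg hG ((inf_le_inf_right _ (abs_add_le z w)).trans
      (inf_add_le_add_inf (abs_nonneg z) (abs_nonneg w) (smul_nonneg (Nat.cast_nonneg k) hb)))

theorem carrierSeminorm_smul (hG : ∀ x, 0 ≤ x → 0 ≤ G x) (hb : 0 ≤ b) {c : ℝ} (hc : 0 < c)
    (z : F) : carrierSeminorm G b (c • z) = c * carrierSeminorm G b z := by
  have key : ∀ {c : ℝ}, 0 < c → ∀ z : F,
      carrierSeminorm G b (c • z) ≤ c * carrierSeminorm G b z := fun {c} hc z =>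
    ciSup_le fun k => by
      refine le_trans ?_ (mul_le_mul_of_nonneg_left (le_carrierSeminorm hG b z ⌈k / c⌉₊) hc.le)
      rw [← smul_eq_mul, ← map_smul, smul_inf_of_nonneg hc.le, smul_smul]
      refine map_le_map_of_nonneg hG (inf_le_inf (abs_le'.2 ⟨?_, ?_⟩)
        (smul_le_smul_of_nonneg_right ?_ hb))
      · exact smul_le_smul_of_nonneg_left (le_abs_self z) hc.le
      · rw [← smul_neg]
        exact smul_le_smul_of_nonneg_left (neg_le_abs z) hc.le
      rw [← div_le_iff₀' hc]
      exact Nat.le_ceil _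
  refine le_antisymm (key hc z) ?_
  have := key (inv_pos.2 hc) (c • z)
  rwa [smul_smul, inv_mul_cancel₀ hc.ne', one_smul, ← div_eq_inv_mul, le_div_iff₀' hc] at this

theorem sum_carrierSeminorm_le (hG : ∀ x, 0 ≤ x → 0 ≤ G x) {d : ℕ → F} (hd : ∀ n, 0 ≤ d n)
    (hdisj : ∀ n m, n ≠ m → d n ⊓ d m = 0) (z : F) (N : ℕ) :
    ∑ n ∈ Finset.range N, carrierSeminorm G (d n) z ≤ G |z| := by
  refine le_of_tendsto' (tendsto_finsetSum (Finset.range N) fun n _ =>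
    tendsto_carrierSeminorm hG (hd n) z) fun k => ?_
  rw [← map_sum]
  refine map_le_map_of_nonneg hG (sum_inf_le_of_pairwise_inf_eq_zero (abs_nonneg z)
    (fun n => smul_nonneg (Nat.cast_nonneg k) (hd n)) (fun n m hnm => ?_) N)
  rw [← smul_inf_of_nonneg (Nat.cast_nonneg k), hdisj n m hnm, smul_zero]

end

/-! ### Hahn–Banach and the main theorem. -/

theorem exists_linearMap_eq_of_sublinear {F : Type*} [AddCommGroup F] [Module ℝ F] (p : F → ℝ)
    (hsmul : ∀ c : ℝ, 0 < c → ∀ x, p (c • x) = c * p x) (hadd : ∀ x y, p (x + y) ≤ p x + p y)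
    (hneg : ∀ x, p (-x) = p x) (v : F) :
    ∃ h : F →ₗ[ℝ] ℝ, h v = p v ∧ ∀ x, |h x| ≤ p x := by
  have h0 : p 0 = 0 := by
    have := hsmul 2 two_pos 0
    rw [smul_zero] at this
    linarith
  have hp : ∀ x, 0 ≤ p x := fun x => by
    have := hadd x (-x)
    rw [add_neg_cancel, h0, hneg] at this
    linarith
  have hext : ∀ h : F →ₗ[ℝ] ℝ, (∀ x, h x ≤ p x) → ∀ x, |h x| ≤ p x := fun h hle x =>
    abs_le'.2 ⟨hle x, by rw [← map_neg, ← hneg]; exact hle _⟩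
  have hker : ∀ c : ℝ, c • v = 0 → (RingHom.id ℝ) c • p v = 0 := fun c hc => by
    rcases smul_eq_zero.1 hc with rfl | rfl
    · simp
    · simp [h0]
  obtain ⟨h, heq, hle⟩ := exists_extension_of_le_sublinear
    (LinearPMap.mkSpanSingleton' v (p v) hker) p hsmul hadd (by
      rintro ⟨x, hx⟩
      obtain ⟨c, rfl⟩ := Submodule.mem_span_singleton.1 hx
      rw [LinearPMap.mkSpanSingleton'_apply, RingHom.id_apply, smul_eq_mul]
      rcases lt_trichotomy c 0 with hc | rfl | hc
      · exact (mul_nonpos_of_nonpos_of_nonneg hc.le (hp v)).trans (hp _)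
      · simp [h0]
      · exact (hsmul c hc v).ge)
  exact ⟨h, (heq ⟨v, Submodule.mem_span_singleton_self v⟩).trans
    (LinearPMap.mkSpanSingleton'_apply_self _ _ _ _), hext h hle⟩

theorem mainTheorem2
    {E : Type*} [NormedAddCommGroup E] [NormedSpace ℝ E] [CompleteSpace E]
    [Lattice E] [IsOrderedAddMonoid E] [IsOrderedModule ℝ E] [HasSolidNorm E]
    {F : Type*} [NormedAddCommGroup F] [NormedSpace ℝ F] [CompleteSpace F]
    [Lattice F] [IsOrderedAddMonoid F] [IsOrderedModule ℝ F] [HasSolidNorm F]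
    (T : E →L[ℝ] F) (K : Set E) (hK : IsDisjointlyWeaklyCompact K) :
    IsDisjointlyWeaklyCompact (T '' K) := by
  refine ⟨T.lipschitz.isBounded_image hK.1, fun y hy hyK => ?_⟩
  rw [tendsto_toWeakSpace_zero_iff]
  intro g
  by_contra hcon
  obtain ⟨ε, hε, hfreq⟩ : ∃ ε > 0, ∃ᶠ n in atTop, ε ≤ |g (y n)| := by
    rw [Metric.tendsto_nhds] at hcon
    push Not at hcon
    simpa [Real.dist_eq] using hcon
  obtain ⟨k, hk, hkε⟩ := extraction_of_frequently_atTop hfreq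
  choose x hxK hyx using fun n => (hyK (k n) : ∃ z ∈ T '' K, |y (k n)| ≤ |z|)
  choose x' hx'K hx' using hxK
  obtain ⟨G, hG, hgG⟩ := exists_positive_majorant (fun z => |g z|) ‖g‖ (fun z => abs_nonneg _)
    (fun z => by simp) (fun z w => by rw [map_add]; exact abs_add_le _ _)
    (fun l hl => list_sum_abs_le (g : F →ₗ[ℝ] ℝ) (norm_nonneg g) g.le_opNorm l hl)
  let d : ℕ → F := fun n => |y (k n)|
  have hd : ∀ n, 0 ≤ d n := fun n => abs_nonneg _
  have hdisj : ∀ n m, n ≠ m → d n ⊓ d m = 0 := fun n m hnm => hy _ _ (hk.injective.ne hnm)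
  have hG' : ∀ z, 0 ≤ z → 0 ≤ (G : F →ₗ[ℝ] ℝ) z := hG
  choose h hhx hhle using fun n => exists_linearMap_eq_of_sublinear
    (carrierSeminorm (G : F →ₗ[ℝ] ℝ) (d n)) (fun c hc z => carrierSeminorm_smul hG' (hd n) hc z)
    (carrierSeminorm_add_le hG' (hd n)) (carrierSeminorm_neg _ (d n)) (T (x' n))
  obtain ⟨n, hn⟩ := hK.exists_apply_lt (fun n => h n ∘ₗ (T : E →ₗ[ℝ] F))
    (C := ‖G‖ * ‖T‖) (by positivity) (fun N z => by
      refine (Finset.sum_le_sum fun n _ => hhle n (T z)).trans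
        ((sum_carrierSeminorm_le hG' hd hdisj (T z) N).trans ?_)
      refine (le_abs_self _).trans ((G.le_opNorm _).trans ?_)
      rw [norm_abs_eq_norm, mul_assoc]
      exact mul_le_mul_of_nonneg_left (T.le_opNorm z) (norm_nonneg G)) hx'K hε
  refine absurd hn (not_lt.2 ?_)
  calc ε ≤ |g (y (k n))| := hkε n
    _ ≤ G |y (k n)| := hgG _
    -- Since d n ≤ |T (x' n)|, the index 1 in the carrier supremum already gives G (d n).
    _ = (G : F →ₗ[ℝ] ℝ) (|T (x' n)| ⊓ ((1 : ℕ) : ℝ) • d n) := by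
      rw [Nat.cast_one, one_smul, hx', inf_eq_right.2 (hyx n)]
      rfl
    _ ≤ carrierSeminorm (G : F →ₗ[ℝ] ℝ) (d n) (T (x' n)) := le_carrierSeminorm hG' _ _ 1
    _ = h n (T (x' n)) := (hhx n).symm
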